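/- For $\pi\in S_n$ and $\tau\in S_k$, say that $\pi$ avoids the pattern $\tau$ if no subsequence of $\pi_1\pi_2\cdots\pi_n$ is order isomorphic to $\tau$. Let $\mathcal{C}_n(524361)=\operatorname{Av}_n(2143,3142,524361)$ be the set of permutations in $S_n$ that avoid all three of the patterns $2143$, $3142$ and $524361$. Then, as formal power series over $\mathbb{Q}$, $$\sum_{n\ge 0}|\mathcal{C}_n(524361)|\,x^n=\frac{3-x-\sqrt{1-6x+x^2}}{2},$$ where $\sqrt{1-6x+x^2}$ is the formal square root with constant term $1$. That is, these permutations are counted by the large Schröder numbers: $|\mathcal{C}_0(524361)|=1$ and $|\mathcal{C}_{n+1}(524361)|=s_n$ for all $n\ge 0$, where $s_0=1$ and $s_{n+1}=s_n+\sum_{i=0}^{n}s_i s_{n-i}$ (so $s_n=1,2,6,22,90,394,\dots$). -/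

import Mathlib

namespace PermPattern

/-- A permutation `π ∈ S_n` is an element of `Equiv.Perm (Fin n)`, its one-line notation being
`π 0, π 1, …, π (n - 1)` (positions and values start at `0` instead of `1`).
`Contains π τ`: some subsequence of `π`, at the increasing positions `f 0 < f 1 < ⋯`, is order
isomorphic to `τ`. -/
def Contains {n k : ℕ} (π : Equiv.Perm (Fin n)) (τ : Equiv.Perm (Fin k)) : Prop :=
  ∃ f : Fin k ↪o Fin n, ∀ i j : Fin k, π (f i) < π (f j) ↔ τ i < τ j

/-- `Avoids π τ`: no subsequence of `π` is order isomorphic to `τ`. -/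
def Avoids {n k : ℕ} (π : Equiv.Perm (Fin n)) (τ : Equiv.Perm (Fin k)) : Prop :=
  ¬ Contains π τ

/-- `Av T n` is the set of the permutations of length `n` that avoid all patterns in `T`, where the
patterns in `T` may have different lengths. -/
def Av (T : Set (Σ k : ℕ, Equiv.Perm (Fin k))) (n : ℕ) : Set (Equiv.Perm (Fin n)) :=
  {π | ∀ τ ∈ T, Avoids π τ.2}

/-- The pattern `2143`. -/
def p2143 : Equiv.Perm (Fin 4) where
  toFun := ![1, 0, 3, 2]
  invFun := ![1, 0, 3, 2]
  left_inv := by decide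
  right_inv := by decide

/-- The pattern `3142`. -/
def p3142 : Equiv.Perm (Fin 4) where
  toFun := ![2, 0, 3, 1]
  invFun := ![1, 3, 0, 2]
  left_inv := by decide
  right_inv := by decide

/-- The pattern `524361`. -/
def p524361 : Equiv.Perm (Fin 6) where
  toFun := ![4, 1, 3, 2, 5, 0]
  invFun := ![5, 1, 3, 2, 0, 4]
  left_inv := by decide
  right_inv := by decide

/-- The class `𝒞(τ) = Av(2143, 3142, τ)`, refined by length: `classC τ n = 𝒞_n(τ)`. -/
def classC {k : ℕ} (τ : Equiv.Perm (Fin k)) (n : ℕ) : Set (Equiv.Perm (Fin n)) :=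
  Av {⟨4, p2143⟩, ⟨4, p3142⟩, ⟨k, τ⟩} n

/-- The ordinary generating function `∑_{n ≥ 0} |𝒞_n(τ)| xⁿ`, as a formal power series. -/
noncomputable def genFun {k : ℕ} (τ : Equiv.Perm (Fin k)) : PowerSeries ℚ :=
  PowerSeries.mk fun n => ((classC τ n).ncard : ℚ)

/-- `IsPrincipalSqrt S f`: the formal power series `S` is the square root of `f` with constant
term `1` (there is at most one such `S`, see `IsPrincipalSqrt.unique`). -/
def IsPrincipalSqrt (S f : PowerSeries ℚ) : Prop :=
  S ^ 2 = f ∧ PowerSeries.constantCoeff S = 1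

theorem IsPrincipalSqrt.unique {S S' f : PowerSeries ℚ} (h : IsPrincipalSqrt S f)
    (h' : IsPrincipalSqrt S' f) : S = S' := by
  rcases sq_eq_sq_iff_eq_or_eq_neg.mp (h.1.trans h'.1.symm) with e | e
  · exact e
  · exfalso
    have h1 := h.2
    rw [e, map_neg, h'.2] at h1
    norm_num at h1

end PermPattern

/-! Write a nonempty permutation avoiding 2143 and 3142 as `L n R` with `n` its maximum, and let `m`
be one more than the largest entry of `R`, or 0 if `R` is empty. A descent `b a` in `L` with `a < m`
would form 2143 or 3142 together with `n` and `m - 1`. Hence `L = X B` with `X` increasing and below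
`m`, and all entries of `B` at least `m`. Conversely, such a permutation is obtained exactly once
from a smaller one `s = X R`, a cut `k` inside the initial run of `s` before its maximum, and an
arbitrary smaller one `B` (`glue`, `sum_baseClass_succ`).

The third pattern respects this gluing. If `R` is nonempty, `n` and an entry of `R` complete a 4132
in `B` to a 524361, so `B` has to avoid 4132 (`has524361_glue`); avoiding 4132 in turn requires that
`R` avoid 132 (`has4132_glue`). Weighting run lengths and cuts by `u` turns this into functional
equations. The sum over cuts is geometric, so (1 - u) H = C - u F(u), where C = F(1) is the wanted
series.

The kernel method finishes the proof: `solve_kernel` eliminates everything except H and C, at the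
value of `u` for which the coefficient of H vanishes. That value is (1 + S)/2 with S the Schröder
series, and C = 1 + xS results. As this `u` depends on x, weights take values in ℚ⟦x⟧ while length
is marked by another variable y; `diagonal` sets y = x afterwards. -/

namespace PermPattern

/-! ### Initial increasing runs of lists. -/

open List

/-- The length of the initial increasing run of a list. -/
def initRun : List ℕ → ℕ
  | [] => 0
  | [_] => 1
  | a :: b :: l => if a < b then initRun (b :: l) + 1 else 1

theorem initRun_cons_of_forall_lt {a : ℕ} {l : List ℕ} (h : ∀ b ∈ l, a < b) :
    initRun (a :: l) = initRun l + 1 := by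
  cases l with
  | nil => rfl
  | cons b l => simp [initRun, h b (by simp)]

theorem initRun_append {X B : List ℕ} (hX : X.Pairwise (· < ·)) (h : ∀ x ∈ X, ∀ y ∈ B, x < y) :
    initRun (X ++ B) = X.length + initRun B := by
  induction X with
  | nil => simp
  | cons a X ih =>
    rw [pairwise_cons] at hX
    rw [cons_append, initRun_cons_of_forall_lt, ih hX.2 fun x hx => h x (by simp [hx])]
    · simp; omega
    · intro b hb
      rcases mem_append.1 hb with hb | hb
      · exact hX.1 b hb
      · exact h a (by simp) b hb

theorem initRun_map_add (m : ℕ) (l : List ℕ) : initRun (l.map (· + m)) = initRun l := by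
  induction l using initRun.induct with
  | case1 => rfl
  | case2 => rfl
  | case3 a b l h ih => simp_all [initRun]
  | case4 a b l h => simp [initRun, h]

theorem le_initRun_iff {l : List ℕ} {k : ℕ} :
    k ≤ initRun l ↔ k ≤ l.length ∧ (l.take k).Pairwise (· < ·) := by
  induction l using initRun.induct generalizing k with
  | case1 => cases k <;> simp [initRun]
  | case2 => rcases k with _ | _ | k <;> simp [initRun]
  | case3 a b l h ih =>
    rcases k with _ | _ | k
    · simp
    · simp [initRun, h]
    · have := ih (k := k + 1)
      simp only [initRun, h, if_true, Nat.add_le_add_iff_right, length_cons, take_succ_cons,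
        pairwise_cons, mem_cons] at this ⊢
      rw [this]
      constructor
      · rintro ⟨h1, h2, h3⟩
        refine ⟨h1, ?_, h2, h3⟩
        rintro c (rfl | hc)
        · exact h
        · exact h.trans (h2 c hc)
      · rintro ⟨h1, -, h2, h3⟩
        exact ⟨h1, h2, h3⟩
  | case4 a b l h =>
    rcases k with _ | _ | k
    · simp
    · simp [initRun, h]
    · simp [initRun, h]

theorem initRun_le_length (l : List ℕ) : initRun l ≤ l.length :=
  (le_initRun_iff.1 le_rfl).1

theorem initRun_eq_length_iff {l : List ℕ} :
    initRun l = l.length ↔ l.Pairwise (· < ·) := by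
  have := le_initRun_iff (l := l) (k := l.length)
  have h2 := initRun_le_length l
  simp only [le_refl, true_and, take_length] at this
  rw [← this]
  omega

/-- The run passes into `n` only if it exhausts `L`, and it always stops there because `R` lies
below `n`. -/
theorem initRun_append_cons {L R : List ℕ} {n : ℕ} (hL : ∀ x ∈ L, x < n) (hR : ∀ x ∈ R, x < n) :
    initRun (L ++ n :: R) = initRun L + if initRun L = L.length then 1 else 0 := by
  induction L using initRun.induct with
  | case1 =>
    cases R with
    | nil => simp [initRun]
    | cons r R => simp [initRun, (hR r (by simp)).le]
  | case2 a =>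
    cases R with
    | nil => simp [initRun, hL a (by simp)]
    | cons r R => simp [initRun, (hR r (by simp)).le, hL a (by simp)]
  | case3 a b l h ih =>
    have := ih fun x hx => hL x (by simp_all)
    simp only [cons_append, initRun, h, if_true, length_cons] at this ⊢
    rw [this]
    simp only [Nat.add_right_cancel_iff]
    omega
  | case4 a b l h => simp [initRun, h]

/-! ### Pattern containment for lists and under gluing. -/

/-- `l` contains `2143` or `3142` (for lists without repetitions). -/
def HasDescentsUp (l : List ℕ) : Prop :=
  ∃ b a d c, [b, a, d, c] <+ l ∧ a < b ∧ a < c ∧ b < d ∧ c < d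

/-- `l` contains `132`. -/
def Has132 (l : List ℕ) : Prop :=
  ∃ a d c, [a, d, c] <+ l ∧ a < c ∧ c < d

/-- `l` contains `4132`. -/
def Has4132 (l : List ℕ) : Prop :=
  ∃ e a d c, [e, a, d, c] <+ l ∧ a < c ∧ c < d ∧ d < e

/-- `l` contains `524361`. -/
def Has524361 (l : List ℕ) : Prop :=
  ∃ e b d c f a, [e, b, d, c, f, a] <+ l ∧ a < b ∧ b < c ∧ c < d ∧ d < e ∧ e < f

theorem hasDescentsUp_map_add (m : ℕ) (l : List ℕ) :
    HasDescentsUp (l.map (· + m)) ↔ HasDescentsUp l := by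
  constructor
  · rintro ⟨b, a, d, c, h, h1, h2, h3, h4⟩
    obtain ⟨w, hw, e⟩ := sublist_map_iff.1 h
    rcases w with _ | ⟨b', _ | ⟨a', _ | ⟨d', _ | ⟨c', _ | _⟩⟩⟩⟩ <;> simp at e
    obtain ⟨rfl, rfl, rfl, rfl⟩ := e
    exact ⟨b', a', d', c', hw, by omega, by omega, by omega, by omega⟩
  · rintro ⟨b, a, d, c, h, h1, h2, h3, h4⟩
    exact ⟨_, _, _, _, h.map _, by simpa, by simpa, by simpa, by simpa⟩

theorem has132_map_add (m : ℕ) (l : List ℕ) :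
    Has132 (l.map (· + m)) ↔ Has132 l := by
  constructor
  · rintro ⟨a, d, c, h, h1, h2⟩
    obtain ⟨w, hw, e⟩ := sublist_map_iff.1 h
    rcases w with _ | ⟨a', _ | ⟨d', _ | ⟨c', _ | _⟩⟩⟩ <;> simp at e
    obtain ⟨rfl, rfl, rfl⟩ := e
    exact ⟨a', d', c', hw, by omega, by omega⟩
  · rintro ⟨a, d, c, h, h1, h2⟩
    exact ⟨_, _, _, h.map _, by simpa, by simpa⟩

theorem has4132_map_add (m : ℕ) (l : List ℕ) :
    Has4132 (l.map (· + m)) ↔ Has4132 l := by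
  constructor
  · rintro ⟨b, a, d, c, h, h1, h2, h3⟩
    obtain ⟨w, hw, e⟩ := sublist_map_iff.1 h
    rcases w with _ | ⟨b', _ | ⟨a', _ | ⟨d', _ | ⟨c', _ | _⟩⟩⟩⟩ <;> simp at e
    obtain ⟨rfl, rfl, rfl, rfl⟩ := e
    exact ⟨b', a', d', c', hw, by omega, by omega, by omega⟩
  · rintro ⟨b, a, d, c, h, h1, h2, h3⟩
    exact ⟨_, _, _, _, h.map _, by simpa, by simpa, by simpa⟩

theorem has524361_map_add (m : ℕ) (l : List ℕ) :
    Has524361 (l.map (· + m)) ↔ Has524361 l := by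
  constructor
  · rintro ⟨e, b, d, c, f, a, h, h1, h2, h3, h4, h5⟩
    obtain ⟨w, hw, e⟩ := sublist_map_iff.1 h
    rcases w with _ | ⟨e', _ | ⟨b', _ | ⟨d', _ | ⟨c', _ | ⟨f', _ | ⟨a', _ | _⟩⟩⟩⟩⟩⟩ <;> simp at e
    obtain ⟨rfl, rfl, rfl, rfl, rfl, rfl⟩ := e
    exact ⟨e', b', d', c', f', a', hw, by omega, by omega, by omega, by omega, by omega⟩
  · rintro ⟨e, b, d, c, f, a, h, h1, h2, h3, h4, h5⟩
    exact ⟨_, _, _, _, _, _, h.map _, by simpa, by simpa, by simpa, by simpa, by simpa⟩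

/-- The situation of `X ++ (B ++ n :: R)`, where `X` is increasing and the entries of `B` lie
between those of `X` and `R` on the one hand and `n` on the other. -/
structure IsGluing (X B R : List ℕ) (m n : ℕ) : Prop where
  sorted : X.Pairwise (· < ·)
  ltX : ∀ x ∈ X, x < m
  ltR : ∀ x ∈ R, x < m
  leB : ∀ x ∈ B, m ≤ x
  ltB : ∀ x ∈ B, x < n
  nodup : (X ++ R).Nodup
  le : m ≤ n

namespace IsGluing

variable {X B R : List ℕ} {m n : ℕ}

theorem filter_lt (h : IsGluing X B R m n) :
    (X ++ (B ++ n :: R)).filter (· < m) = X ++ R := by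
  have h1 : X.filter (· < m) = X := filter_eq_self.2 (by simpa using h.ltX)
  have h2 : R.filter (· < m) = R := filter_eq_self.2 (by simpa using h.ltR)
  have h3 : B.filter (· < m) = [] := filter_eq_nil_iff.2 (by simpa using h.leB)
  simp [h1, h2, h3, h.le]

theorem filter_ge (h : IsGluing X B R m n) :
    (X ++ (B ++ n :: R)).filter (m ≤ ·) = B ++ [n] := by
  have h1 : X.filter (m ≤ ·) = [] := filter_eq_nil_iff.2 (by simpa using h.ltX)
  have h2 : R.filter (m ≤ ·) = [] := filter_eq_nil_iff.2 (by simpa using h.ltR)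
  have h3 : B.filter (m ≤ ·) = B := filter_eq_self.2 (by simpa using h.leB)
  simp [h1, h2, h3, h.le]

theorem sublist_low (h : IsGluing X B R m n) {w : List ℕ} (hw : w <+ X ++ (B ++ n :: R))
    (hl : ∀ x ∈ w, x < m) : w <+ X ++ R := by
  have := hw.filter (· < m)
  rwa [h.filter_lt, filter_eq_self.2 (by simpa using hl)] at this

theorem sublist_high (h : IsGluing X B R m n) {w : List ℕ} (hw : w <+ X ++ (B ++ n :: R))
    (hl : ∀ x ∈ w, m ≤ x) : w <+ B ++ [n] := by
  have := hw.filter (m ≤ ·)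
  rwa [h.filter_ge, filter_eq_self.2 (by simpa using hl)] at this

theorem low_sublist (X B R : List ℕ) (n : ℕ) : X ++ R <+ X ++ (B ++ n :: R) :=
  (Sublist.refl X).append ((sublist_cons_self n R).trans (sublist_append_right B _))

theorem mid_sublist (X B R : List ℕ) (n : ℕ) : B <+ X ++ (B ++ n :: R) :=
  (sublist_append_left B _).trans (sublist_append_right X _)

/-- Entries below `m` lie in `X` or `R`, and an entry of `X` is preceded only by smaller entries.
With `mem_right`, this forces everything after a low descent bottom into `R`. -/
theorem descent (h : IsGluing X B R m n) {p q : ℕ} (hw : [p, q] <+ X ++ (B ++ n :: R))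
    (hqp : q < p) (hq : q < m) : q ∈ R := by
  obtain ⟨l1, l2, e, h1, h2⟩ := sublist_append_iff.1 hw
  have key : q ∈ B ++ n :: R → q ∈ R := by
    intro hqq
    rcases mem_append.1 hqq with h' | h'
    · exact absurd (h.leB q h') (by omega)
    · rcases mem_cons.1 h' with h' | h'
      · have := h.le; omega
      · exact h'
  rcases l1 with _ | ⟨a, _ | ⟨b, l1⟩⟩
  · simp at e; subst e
    exact key (h2.subset (by simp))
  · simp at e
    obtain ⟨rfl, rfl⟩ := e
    exact key (h2.subset (by simp))
  · simp at e
    obtain ⟨rfl, rfl, rfl, rfl⟩ := e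
    exact absurd (pairwise_iff_forall_sublist.1 h.sorted h1) (by omega)

theorem mem_right (h : IsGluing X B R m n) {q r : ℕ} (hw : [q, r] <+ X ++ (B ++ n :: R))
    (hq : q ∈ R) : r ∈ R := by
  have hqX : q ∉ X := fun hX => (nodup_append.1 h.nodup).2.2 q hX q hq rfl
  have hqB : q ∉ B := fun hB => absurd (h.leB q hB) (by have := h.ltR q hq; omega)
  have hqn : q ≠ n := by have := h.ltR q hq; have := h.le; omega
  obtain ⟨l1, l2, e, h1, h2⟩ := sublist_append_iff.1 hw
  rcases l1 with _ | ⟨a, l1⟩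
  · simp at e; subst e
    obtain ⟨l1, l2, e, h1, h2⟩ := sublist_append_iff.1 h2
    rcases l1 with _ | ⟨a, l1⟩
    · simp at e; subst e
      rcases sublist_cons_iff.1 h2 with h2 | ⟨s, h3, -⟩
      · exact h2.subset (by simp)
      · simp at h3; exact absurd h3.1 hqn
    · simp at e
      exact absurd (h1.subset (by simp [e.1])) hqB
  · simp at e
    exact absurd (h1.subset (by simp [e.1])) hqX

theorem sublist_of_append_singleton {w : List ℕ} {c : ℕ}
    (hw : w ++ [c] <+ B ++ [n]) (hc : c ≠ n) : w ++ [c] <+ B := by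
  obtain ⟨l1, l2, e, h1, h2⟩ := sublist_append_iff.1 hw
  rcases l2.eq_nil_or_concat with rfl | ⟨l3, x, rfl⟩
  · simp at e; rwa [← e] at h1
  · have : x = n := by
      have := h2.subset (a := x) (by simp)
      simpa using this
    have hcx : c = x := by simpa using congrArg getLast? e
    omega

/-- If `a` is low and `d` is not, then `a` and hence `d` belong to `R`, a contradiction. So an
occurrence is entirely low or entirely high, and in the latter case it misses `n` because its last
letter is not its largest. -/
theorem hasDescentsUp_iff (h : IsGluing X B R m n) :
    HasDescentsUp (X ++ (B ++ n :: R)) ↔ HasDescentsUp (X ++ R) ∨ HasDescentsUp B := by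
  constructor
  · rintro ⟨b, a, d, c, hw, h1, h2, h3, h4⟩
    by_cases hd : d < m
    · left
      refine ⟨b, a, d, c, h.sublist_low hw ?_, h1, h2, h3, h4⟩
      simp; omega
    · by_cases ha : a < m
      · have haR := h.descent (p := b) (Sublist.trans (by simp) hw) h1 ha
        have := h.mem_right (q := a) (r := d) (Sublist.trans (by simp) hw) haR
        exact absurd (h.ltR d this) hd
      · right
        have hh := h.sublist_high hw (by simp; omega)
        have hdn : d ≤ n := by
          have := hh.subset (a := d) (by simp)
          rcases mem_append.1 this with h' | h'
          · exact (h.ltB d h').le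
          · simp at h'; omega
        exact ⟨b, a, d, c, sublist_of_append_singleton (w := [b, a, d]) hh (by omega), h1, h2, h3, h4⟩
  · rintro (⟨b, a, d, c, hw, hh⟩ | ⟨b, a, d, c, hw, hh⟩)
    · exact ⟨b, a, d, c, hw.trans (low_sublist X B R n), hh⟩
    · exact ⟨b, a, d, c, hw.trans (mid_sublist X B R n), hh⟩

/-- A low 1 must lie in `R` together with the letters after it; conversely `n` plays the 4 in front
of any 132 in `R`. -/
theorem has4132_iff (h : IsGluing X B R m n) :
    Has4132 (X ++ (B ++ n :: R)) ↔ Has132 R ∨ Has4132 B := by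
  constructor
  · rintro ⟨e, a, d, c, hw, h1, h2, h3⟩
    by_cases ha : a < m
    · left
      have haR := h.descent (p := e) (Sublist.trans (by simp) hw) (by omega) ha
      have hd := h.mem_right (q := a) (r := d) (Sublist.trans (by simp) hw) haR
      have hdm := h.ltR d hd
      have hw' : [a, d, c] <+ X ++ R :=
        h.sublist_low (Sublist.trans (by simp) hw) (by simp; omega)
      obtain ⟨l1, l2, e, h3, h4⟩ := sublist_append_iff.1 hw'
      rcases l1 with _ | ⟨x, l1⟩
      · simp at e; subst e
        exact ⟨a, d, c, h4, h1, h2⟩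
      · simp at e
        exact absurd rfl ((nodup_append.1 h.nodup).2.2 a (h3.subset (by simp [e.1])) a haR)
    · right
      have hh := h.sublist_high hw (by simp; omega)
      have hdn : d ≤ n := by
        have := hh.subset (a := d) (by simp)
        rcases mem_append.1 this with h' | h'
        · exact (h.ltB d h').le
        · simp at h'; omega
      exact ⟨e, a, d, c, sublist_of_append_singleton (w := [e, a, d]) hh (by omega), h1, h2, h3⟩
  · rintro (⟨a, d, c, hw, h1, h2⟩ | ⟨e, a, d, c, hw, hh⟩)
    · refine ⟨n, a, d, c, ((hw.cons_cons n).trans (sublist_append_right B _)).trans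
        (sublist_append_right X _), h1, h2, ?_⟩
      have := h.ltR d (hw.subset (by simp))
      have := h.le
      omega
    · exact ⟨e, a, d, c, hw.trans (mid_sublist X B R n), hh⟩

/-- The mixed occurrences are those whose final 1 alone is low: the letters 5243 then form a 4132 in
`B`. Conversely `n` and any entry of `R` supply the 6 and the 1. -/
theorem has524361_iff (h : IsGluing X B R m n) :
    Has524361 (X ++ (B ++ n :: R)) ↔
      Has524361 (X ++ R) ∨ Has524361 B ∨ (R ≠ [] ∧ Has4132 B) := by
  constructor
  · rintro ⟨e, b, d, c, f, a, hw, h1, h2, h3, h4, h5⟩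
    by_cases hf : f < m
    · left
      refine ⟨e, b, d, c, f, a, h.sublist_low hw ?_, h1, h2, h3, h4, h5⟩
      simp; omega
    right
    have hfn : f ≤ n := by
      by_contra hfn
      have := hw.subset (a := f) (by simp)
      simp only [mem_append, mem_cons] at this
      rcases this with h' | h' | h' | h'
      · exact hf (h.ltX _ h')
      · have := h.ltB _ h'; omega
      · omega
      · exact hf (h.ltR _ h')
    have hb : ¬ b < m := by
      intro hb
      have hbR := h.descent (p := e) (Sublist.trans (by simp) hw) (by omega) hb
      exact hf (h.ltR f (h.mem_right (q := b) (r := f) (Sublist.trans (by simp) hw) hbR))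
    by_cases ha : a < m
    · right
      have haR := h.descent (p := f) (q := a)
        (Sublist.trans (sublist_append_right [e, b, d, c] [f, a]) hw) (by omega) ha
      refine ⟨ne_nil_of_mem haR, e, b, d, c, ?_, h2, h3, h4⟩
      have hh : [e, b, d, c] <+ B ++ [n] :=
        h.sublist_high (Sublist.trans (by simp) hw) (by simp; omega)
      exact sublist_of_append_singleton (w := [e, b, d]) hh (by omega)
    · left
      have hh := h.sublist_high hw (by simp; omega)
      exact ⟨e, b, d, c, f, a, sublist_of_append_singleton (w := [e, b, d, c, f]) hh (by omega), h1, h2, h3, h4,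
        h5⟩
  · rintro (⟨e, b, d, c, f, a, hw, hh⟩ | ⟨e, b, d, c, f, a, hw, hh⟩ |
      ⟨hR, e, b, d, c, hw, h1, h2, h3⟩)
    · exact ⟨e, b, d, c, f, a, hw.trans (low_sublist X B R n), hh⟩
    · exact ⟨e, b, d, c, f, a, hw.trans (mid_sublist X B R n), hh⟩
    · obtain ⟨r, hr⟩ := exists_mem_of_ne_nil R hR
      refine ⟨e, b, d, c, n, r, ?_, ?_, h1, h2, h3, h.ltB e (hw.subset (by simp))⟩
      · have : [n, r] <+ n :: R := by simpa using hr
        exact (hw.append this).trans (sublist_append_right X _)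
      · have := h.ltR r hr
        have := h.leB b (hw.subset (by simp))
        omega

theorem has132_mid_iff (hB : ∀ x ∈ B, m ≤ x) (hBn : ∀ x ∈ B, x < n) (hR : ∀ x ∈ R, x < m)
    (hmn : m ≤ n) :
    Has132 (B ++ n :: R) ↔ Has132 B ∨ Has132 R := by
  constructor
  · rintro ⟨a, d, c, hw, h1, h2⟩
    have hn : ∀ x ∈ B ++ n :: R, x ≤ n := by
      simp only [mem_append, mem_cons]
      rintro x (h | h | h)
      · exact (hBn x h).le
      · omega
      · have := hR x h; omega
    have han := hn c (hw.subset (by simp))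
    have hdn := hn d (hw.subset (by simp))
    obtain ⟨l1, l2, e, h3, h4⟩ := sublist_append_iff.1 hw
    have key : ∀ x ∈ n :: R, x < m ∨ x = n := by
      simp only [mem_cons]
      rintro x (h | h)
      · exact .inr h
      · exact .inl (hR x h)
    rcases l1 with _ | ⟨x, l1⟩
    · simp at e; subst e
      rcases sublist_cons_iff.1 h4 with h4 | ⟨s, h5, -⟩
      · exact .inr ⟨a, d, c, h4, h1, h2⟩
      · simp at h5; omega
    · simp only [cons_append, cons.injEq] at e
      obtain ⟨rfl, e⟩ := e
      have ham := hB a (h3.subset (by simp))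
      rcases l2.eq_nil_or_concat with rfl | ⟨l3, y, rfl⟩
      · simp at e; subst e
        exact .inl ⟨a, d, c, h3, h1, h2⟩
      · have hy := key y (h4.subset (by simp))
        have hc : c = y := by
          have := congrArg getLast? e
          simpa using this
        have hdn' : d ∈ B ∨ d < m ∨ d = n := by
          have : d ∈ l1 ++ l3.concat y := e ▸ (by simp)
          rcases mem_append.1 this with h' | h'
          · exact .inl (h3.subset (by simp [h']))
          · exact .inr (key d (h4.subset h'))
        omega
  · rintro (⟨a, d, c, hw, hh⟩ | ⟨a, d, c, hw, hh⟩)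
    · exact ⟨a, d, c, hw.trans (sublist_append_left _ _), hh⟩
    · exact ⟨a, d, c, hw.trans ((sublist_cons_self n R).trans (sublist_append_right _ _)), hh⟩

end IsGluing

end PermPattern

/-! ### The decomposition of permutations avoiding 2143 and 3142. -/

namespace PermPattern

open List

open scoped Classical in
/-- The one-line notations of the permutations of `0, …, n - 1` avoiding `2143` and `3142`. -/
noncomputable def baseClass (n : ℕ) : Finset (List ℕ) :=
  (range n).permutations.toFinset.filter fun l => ¬ HasDescentsUp l

theorem perm_range_iff {n : ℕ} {l : List ℕ} :
    l ~ range n ↔ l.Nodup ∧ ∀ x, x ∈ l ↔ x < n := by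
  constructor
  · intro h
    exact ⟨h.nodup_iff.2 nodup_range, fun x => by rw [h.mem_iff, mem_range]⟩
  · rintro ⟨h1, h2⟩
    rw [perm_ext_iff_of_nodup h1 nodup_range]
    simpa using h2

theorem mem_baseClass {n : ℕ} {l : List ℕ} :
    l ∈ baseClass n ↔ l.Nodup ∧ (∀ x, x ∈ l ↔ x < n) ∧ ¬ HasDescentsUp l := by
  simp [baseClass, perm_range_iff, and_assoc]

theorem length_of_mem_baseClass {n : ℕ} {l : List ℕ} (h : l ∈ baseClass n) : l.length = n := by
  rw [mem_baseClass] at h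
  simpa using (perm_range_iff.2 ⟨h.1, h.2.1⟩).length_eq

/-- The length of the initial increasing run of the part of a permutation before its maximum. -/
def peakRun (l : List ℕ) : ℕ :=
  initRun (l.takeWhile fun x => x + 1 ≠ l.length)

theorem le_peakRun_iff {l : List ℕ} {k : ℕ} :
    k ≤ peakRun l ↔
      k ≤ l.length ∧ (l.take k).Pairwise (· < ·) ∧ ∀ x ∈ l.take k, x + 1 ≠ l.length := by
  rw [peakRun, le_initRun_iff]
  have hp := takeWhile_prefix (fun x => decide (x + 1 ≠ l.length)) (l := l)
  constructor
  · rintro ⟨h1, h2⟩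
    have e := hp.take k
    have e' : (l.takeWhile fun x => x + 1 ≠ l.length).take k = l.take k := by
      refine e.eq_of_length ?_
      have := hp.length_le
      simp only [length_take]
      omega
    rw [e'] at h2
    refine ⟨h1.trans hp.length_le, h2, fun x hx => ?_⟩
    rw [← e'] at hx
    simpa using mem_takeWhile_imp (mem_of_mem_take hx)
  · rintro ⟨h1, h2, h3⟩
    have e : (l.takeWhile fun x => x + 1 ≠ l.length) =
        l.take k ++ (l.drop k).takeWhile fun x => x + 1 ≠ l.length := by
      conv_lhs => rw [← take_append_drop k l]
      rw [takeWhile_append_of_pos]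
      · simp
      · simpa using h3
    have hl : (l.take k).length = k := by simpa using h1
    rw [e]
    refine ⟨by rw [length_append, hl]; omega, ?_⟩
    rwa [take_append_of_le_length (by omega), take_of_length_le (by omega)]

theorem peakRun_append_cons {L R : List ℕ} {n : ℕ} (hL : ∀ x ∈ L, x < n)
    (hn : (L ++ n :: R).length = n + 1) : peakRun (L ++ n :: R) = initRun L := by
  rw [peakRun, hn, takeWhile_append_of_pos]
  · simp
  · intro x hx
    have := hL x hx
    simp; omega

/-- Insert a shifted copy of `L`, followed by the new maximum `n`, at position `k` into `s`. -/
def glue (m n k : ℕ) (s L : List ℕ) : List ℕ :=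
  s.take k ++ (L.map (· + m) ++ n :: s.drop k)

theorem isGluing_of_mem {m j k : ℕ} {s L : List ℕ} (hs : s ∈ baseClass m) (hL : L ∈ baseClass j)
    (hk : k ≤ peakRun s) : IsGluing (s.take k) (L.map (· + m)) (s.drop k) m (m + j) where
  sorted := (le_peakRun_iff.1 hk).2.1
  ltX x hx := ((mem_baseClass.1 hs).2.1 x).1 (mem_of_mem_take hx)
  ltR x hx := ((mem_baseClass.1 hs).2.1 x).1 (mem_of_mem_drop hx)
  leB x hx := by obtain ⟨y, -, rfl⟩ := mem_map.1 hx; omega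
  ltB x hx := by
    obtain ⟨y, hy, rfl⟩ := mem_map.1 hx
    have := ((mem_baseClass.1 hL).2.1 y).1 hy
    omega
  nodup := by rw [take_append_drop]; exact (mem_baseClass.1 hs).1
  le := by omega

/-- The cut comes before the maximum `m - 1` of `s`, so the part after it determines `m`. This makes
the decomposition unique. -/
theorem drop_peak {m k : ℕ} {s : List ℕ} (hs : s ∈ baseClass m) (hk : k ≤ peakRun s) :
    (s.drop k = [] ∧ m = 0) ∨ (0 < m ∧ m - 1 ∈ s.drop k) := by
  have hl := length_of_mem_baseClass hs
  rcases Nat.eq_zero_or_pos m with rfl | hm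
  · left
    rw [length_eq_zero_iff] at hl
    simp [hl]
  · right
    refine ⟨hm, ?_⟩
    have h1 : m - 1 ∈ s := ((mem_baseClass.1 hs).2.1 _).2 (by omega)
    rw [← take_append_drop k s] at h1
    rcases mem_append.1 h1 with h | h
    · have := (le_peakRun_iff.1 hk).2.2 _ h
      omega
    · exact h

theorem glue_mem {m j k : ℕ} {s L : List ℕ} (hs : s ∈ baseClass m) (hL : L ∈ baseClass j)
    (hk : k ≤ peakRun s) : glue m (m + j) k s L ∈ baseClass (m + j + 1) := by
  have hg := isGluing_of_mem hs hL hk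
  have hs' := mem_baseClass.1 hs
  have hL' := mem_baseClass.1 hL
  rw [mem_baseClass, glue, hg.hasDescentsUp_iff, take_append_drop, hasDescentsUp_map_add]
  refine ⟨?_, ?_, by tauto⟩
  · have hp : s.take k ++ (L.map (· + m) ++ (m + j) :: s.drop k) ~
        (m + j) :: (L.map (· + m) ++ s) := by
      conv_rhs => rw [← take_append_drop k s]
      rw [← append_assoc]
      refine perm_middle.trans (.cons _ ?_)
      rw [← append_assoc]
      exact perm_append_comm.append_right _
    rw [hp.nodup_iff, nodup_cons, nodup_append]
    refine ⟨?_, ?_, hs'.1, ?_⟩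
    · simp only [mem_append, not_or]
      exact ⟨fun h => absurd (hg.ltB _ h) (lt_irrefl _), fun h => by
        have := (hs'.2.1 _).1 h; omega⟩
    · exact hL'.1.map (add_left_injective m)
    · intro a ha b hb
      have := hg.leB a ha
      have := (hs'.2.1 _).1 hb
      omega
  · intro x
    have h1 : x ∈ s ↔ x ∈ s.take k ∨ x ∈ s.drop k := by
      rw [← mem_append, take_append_drop]
    have h2 : x ∈ L.map (· + m) ↔ m ≤ x ∧ x < m + j := by
      rw [mem_map]
      constructor
      · rintro ⟨y, hy, rfl⟩
        have := (hL'.2.1 y).1 hy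
        omega
      · rintro ⟨h3, h4⟩
        exact ⟨x - m, (hL'.2.1 _).2 (by omega), by omega⟩
    have h3 := hs'.2.1 x
    simp only [mem_append, mem_cons]
    rw [h2]
    rw [h1] at h3
    constructor
    · rintro (h | h | h | h)
      · have := h3.1 (.inl h); omega
      · omega
      · omega
      · have := h3.1 (.inr h); omega
    · intro h
      by_cases hx : x < m
      · rcases h3.2 hx with h | h <;> simp [h]
      · by_cases hx' : x = m + j
        · simp [hx']
        · right; left; omega

theorem glue_injective {m j m' j' k k' : ℕ} {s L s' L' : List ℕ}
    (hs : s ∈ baseClass m) (hL : L ∈ baseClass j) (hk : k ≤ peakRun s)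
    (hs' : s' ∈ baseClass m') (hL' : L' ∈ baseClass j') (hk' : k' ≤ peakRun s')
    (hn : m + j = m' + j') (h : glue m (m + j) k s L = glue m' (m + j) k' s' L') :
    m = m' ∧ k = k' ∧ s = s' ∧ L = L' := by
  have hg := isGluing_of_mem hs hL hk
  have hg' := isGluing_of_mem hs' hL' hk'
  rw [← hn] at hg'
  have hm : m = m' ∧ s.take k = s'.take k' ∧ s.drop k = s'.drop k' ∧
      L.map (· + m) = L'.map (· + m') := by
    rw [glue, glue, ← append_assoc, ← append_assoc] at h
    have hnot : ∀ {m : ℕ} {X B R : List ℕ} {n : ℕ}, IsGluing X B R m n →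
        n ∉ X ++ B ∧ n ∉ R := by
      intro m X B R n hg
      have := hg.le
      refine ⟨fun hh => ?_, fun hh => ?_⟩
      · rcases mem_append.1 hh with h' | h'
        · have := hg.ltX _ h'; omega
        · have := hg.ltB _ h'; omega
      · have := hg.ltR _ hh; omega
    obtain ⟨h1, -, h2⟩ := (append_cons_inj_of_notMem (hnot hg).1 (hnot hg).2).1 h
    have hmm : m = m' := by
      rcases drop_peak hs hk with ⟨h3, h4⟩ | ⟨h3, h4⟩ <;>
        rcases drop_peak hs' hk' with ⟨h5, h6⟩ | ⟨h5, h6⟩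
      · omega
      · rw [← h2, h3] at h6; simp at h6
      · rw [h2, h5] at h4; simp at h4
      · have h7 := hg'.ltR (m - 1) (h2 ▸ h4)
        have h8 := hg.ltR (m' - 1) (h2 ▸ h6)
        omega
    subst hmm
    -- With `m` known, filtering the entries below `m` separates `X` from `B`.
    have hf := hg.filter_lt
    rw [← append_assoc, h1, h2, append_assoc, hg'.filter_lt] at hf
    have h3 := append_cancel_right hf
    rw [h3] at h1
    exact ⟨rfl, h3.symm, h2, append_cancel_left h1⟩
  obtain ⟨rfl, h1, h2, h3⟩ := hm
  refine ⟨rfl, ?_, ?_, ?_⟩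
  · have h4 := congrArg length h1
    have h5 := (le_peakRun_iff.1 hk).1
    have h6 := (le_peakRun_iff.1 hk').1
    simp only [length_take] at h4
    omega
  · rw [← take_append_drop k s, ← take_append_drop k' s', h1, h2]
  · exact map_injective_iff.2 (add_left_injective m) h3

theorem eq_filter_append_filter {m : ℕ} {l : List ℕ}
    (h : l.Pairwise fun p q => q < m → p < q) :
    l = l.filter (· < m) ++ l.filter (m ≤ ·) := by
  induction l with
  | nil => rfl
  | cons a l ih =>
    rw [pairwise_cons] at h
    by_cases ha : a < m
    · simpa [ha] using ih h.2
    · have hl : ∀ q ∈ l, m ≤ q := by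
        intro q hq
        by_contra hqm
        have := h.1 q hq (by omega)
        omega
      have h1 : l.filter (· < m) = [] := filter_eq_nil_iff.2 (by simpa using hl)
      have h2 : l.filter (m ≤ ·) = l := filter_eq_self.2 (by simpa using hl)
      simp [ha, h1, h2, not_lt.1 ha]

theorem exists_strict_bound (R : List ℕ) :
    ∃ m, (∀ r ∈ R, r < m) ∧ (R = [] ∧ m = 0 ∨ 0 < m ∧ m - 1 ∈ R) := by
  induction R with
  | nil => exact ⟨0, by simp⟩
  | cons a R ih =>
    obtain ⟨m, h1, h2⟩ := ih
    by_cases ham : a < m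
    · refine ⟨m, by simpa [ham] using h1, .inr ?_⟩
      rcases h2 with ⟨-, h2⟩ | h2
      · omega
      · exact ⟨h2.1, mem_cons_of_mem _ h2.2⟩
    · refine ⟨a + 1, ?_, by simp⟩
      simp only [mem_cons, forall_eq_or_imp]
      exact ⟨by omega, fun r hr => by have := h1 r hr; omega⟩

theorem exists_gluing {n : ℕ} {p : List ℕ} (hp : p ∈ baseClass (n + 1)) :
    ∃ m j k s L, m + j = n ∧ s ∈ baseClass m ∧ L ∈ baseClass j ∧ k ≤ peakRun s ∧
      glue m n k s L = p := by
  obtain ⟨hnd, hmem, hbad⟩ := mem_baseClass.1 hp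
  obtain ⟨L, R, rfl⟩ := append_of_mem ((hmem n).2 (by omega))
  obtain ⟨hndL, hndR, hdis⟩ := nodup_append.1 hnd
  obtain ⟨hnR, hndR⟩ := nodup_cons.1 hndR
  have hnL : n ∉ L := fun h => hdis n h n (by simp) rfl
  have hltL : ∀ x ∈ L, x < n := fun x hx => by
    have := (hmem x).1 (by simp [hx])
    have : x ≠ n := fun e => hnL (e ▸ hx)
    omega
  have hltR : ∀ x ∈ R, x < n := fun x hx => by
    have := (hmem x).1 (by simp [hx])
    have : x ≠ n := fun e => hnR (e ▸ hx)
    omega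
  obtain ⟨m, hRm, hm⟩ := exists_strict_bound R
  have hmn : m ≤ n := by
    rcases hm with hm | hm
    · omega
    · have := hltR _ hm.2; omega
  -- A violating descent `b a` extends by `n` and `m - 1` to 2143 or 3142.
  have hpw : L.Pairwise fun p q => q < m → p < q := by
    rw [pairwise_iff_forall_sublist]
    intro b a hba ham
    by_contra hab
    have hne : b ≠ a := by
      have := hndL.sublist hba
      simpa using this
    rcases hm with hm | hm
    · omega
    · have ha : a ≠ m - 1 := by
        rintro rfl
        exact hdis _ (hba.subset (by simp)) _ (mem_cons_of_mem _ hm.2) rfl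
      refine hbad ⟨b, a, n, m - 1, ?_, by omega, by omega, hltL b (hba.subset (by simp)),
        by omega⟩
      have h2 : [n, m - 1] <+ n :: R := by simpa using hm.2
      exact hba.append h2
  have hL := eq_filter_append_filter hpw
  set X := L.filter (· < m) with hX
  set B := L.filter (m ≤ ·) with hB
  have hXm : ∀ x ∈ X, x < m := fun x hx => by simpa using (mem_filter.1 hx).2
  have hBm : ∀ x ∈ B, m ≤ x := fun x hx => by simpa using (mem_filter.1 hx).2
  have hXs : X.Pairwise (· < ·) := by
    refine (hpw.filter _).imp_of_mem ?_
    intro a b ha hb hab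
    exact hab (hXm b hb)
  have hXR : (X ++ R).Nodup := by
    refine hnd.sublist ?_
    exact (filter_sublist (l := L)).append (sublist_cons_self n R)
  have hg : IsGluing X B R m n :=
    ⟨hXs, hXm, hRm, hBm, fun x hx => hltL x (mem_of_mem_filter hx), hXR, hmn⟩
  have hBB : (B.map (· - m)).map (· + m) = B := by
    rw [map_map]
    conv_rhs => rw [← map_id B]
    refine map_congr_left fun x hx => ?_
    have := hBm x hx
    simp; omega
  rw [hL, append_assoc, hg.hasDescentsUp_iff, not_or] at hbad
  have hs : X ++ R ∈ baseClass m := by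
    refine mem_baseClass.2 ⟨hXR, fun x => ⟨fun hx => ?_, fun hx => ?_⟩, hbad.1⟩
    · rcases mem_append.1 hx with h | h
      · exact hXm x h
      · exact hRm x h
    · have := (hmem x).2 (by omega)
      simp only [mem_append, mem_cons] at this
      rcases this with h | h | h
      · exact mem_append_left _ (mem_filter.2 ⟨h, by simpa using hx⟩)
      · omega
      · exact mem_append_right _ h
  refine ⟨m, n - m, X.length, X ++ R, B.map (· - m), by omega, hs, ?_, ?_, ?_⟩
  · refine mem_baseClass.2 ⟨?_, fun x => ?_, ?_⟩
    · refine Nodup.of_map (· + m) ?_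
      rw [hBB]
      exact hndL.filter _
    · rw [mem_map]
      constructor
      · rintro ⟨y, hy, rfl⟩
        have := hBm y hy
        have := hg.ltB y hy
        omega
      · intro hx
        have := (hmem (x + m)).2 (by omega)
        simp only [mem_append, mem_cons] at this
        rcases this with h | h | h
        · exact ⟨x + m, mem_filter.2 ⟨h, by simp⟩, by omega⟩
        · omega
        · have := hRm _ h; omega
    · rw [← hasDescentsUp_map_add m, hBB]
      exact hbad.2
  · rw [le_peakRun_iff, length_of_mem_baseClass hs]
    refine ⟨?_, by simpa using hXs, ?_⟩
    · rw [← length_of_mem_baseClass hs]; simp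
    · simp only [take_left]
      intro x hx hxm
      rcases hm with hm | hm
      · omega
      · obtain rfl : x = m - 1 := by omega
        exact (nodup_append.1 hXR).2.2 _ hx _ hm.2 rfl
  · rw [glue, take_left, drop_left, hBB, ← append_assoc, ← hL]

theorem sum_baseClass_succ {M : Type*} [AddCommMonoid M] (f : List ℕ → M) (n : ℕ) :
    ∑ p ∈ baseClass (n + 1), f p =
      ∑ a ∈ Finset.HasAntidiagonal.antidiagonal n, ∑ s ∈ baseClass a.1, ∑ k ∈ Finset.range (peakRun s + 1),
        ∑ L ∈ baseClass a.2, f (glue a.1 n k s L) := by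
  symm
  let S : Finset (Σ _ : ℕ × ℕ, Σ _ : List ℕ, ℕ × List ℕ) :=
    (Finset.HasAntidiagonal.antidiagonal n).sigma fun a => (baseClass a.1).sigma fun s =>
      Finset.range (peakRun s + 1) ×ˢ baseClass a.2
  have hS : ∀ a s k L, (⟨a, s, k, L⟩ : Σ _ : ℕ × ℕ, Σ _ : List ℕ, ℕ × List ℕ) ∈ S ↔
      a.1 + a.2 = n ∧ s ∈ baseClass a.1 ∧ k ≤ peakRun s ∧ L ∈ baseClass a.2 := by
    intro a s k L
    simp [S]
  trans ∑ x ∈ S, f (glue x.1.1 n x.2.2.1 x.2.1 x.2.2.2)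
  · simp only [S, Finset.sum_sigma, Finset.sum_product]
  refine Finset.sum_nbij (fun x => glue x.1.1 n x.2.2.1 x.2.1 x.2.2.2) ?_ ?_ ?_ fun _ _ => rfl
  · rintro ⟨⟨m, j⟩, s, k, L⟩ hx
    obtain ⟨rfl, hs, hk, hL⟩ := (hS _ _ _ _).1 hx
    exact glue_mem hs hL hk
  · rintro ⟨⟨m, j⟩, s, k, L⟩ hx ⟨⟨m', j'⟩, s', k', L'⟩ hx' h
    obtain ⟨hn, hs, hk, hL⟩ := (hS _ _ _ _).1 hx
    obtain ⟨hn', hs', hk', hL'⟩ := (hS _ _ _ _).1 hx'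
    simp only at hn hn' hs hs' hL hL' h
    subst hn
    obtain ⟨rfl, rfl, rfl, rfl⟩ := glue_injective hs hL hk hs' hL' hk' hn'.symm h
    obtain rfl : j = j' := by omega
    rfl
  · intro p hp
    obtain ⟨m, j, k, s, L, hn, hs, hL, hk, h⟩ := exists_gluing hp
    exact ⟨⟨⟨m, j⟩, s, k, L⟩, (hS _ _ _ _).2 ⟨hn, hs, hk, hL⟩, h⟩

end PermPattern

/-! ### Statistics and patterns of a glued permutation. -/

namespace PermPattern

open List

theorem Has524361.has4132 {l : List ℕ} (h : Has524361 l) : Has4132 l := by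
  obtain ⟨e, b, d, c, f, a, h, h1, h2, h3, h4, h5⟩ := h
  exact ⟨e, b, d, c, (sublist_append_left [e, b, d, c] [f, a]).trans h, h2, h3, h4⟩

theorem not_has4132_of_initRun_eq {l : List ℕ} (h : initRun l = l.length) : ¬ Has4132 l := by
  rw [initRun_eq_length_iff, pairwise_iff_forall_sublist] at h
  rintro ⟨e, a, d, c, hw, h1, h2, h3⟩
  have := h ((sublist_append_left [e, a] [d, c]).trans hw)
  omega

section glue

variable {m j k : ℕ} {s L : List ℕ}

theorem length_glue (hs : s ∈ baseClass m) (hL : L ∈ baseClass j) (hk : k ≤ peakRun s) :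
    (s.take k ++ L.map (· + m) ++ (m + j) :: s.drop k).length = m + j + 1 := by
  have := length_of_mem_baseClass (glue_mem hs hL hk)
  rwa [glue, ← append_assoc] at this

theorem initRun_take_append (hs : s ∈ baseClass m) (hL : L ∈ baseClass j) (hk : k ≤ peakRun s) :
    initRun (s.take k ++ L.map (· + m)) = k + initRun L := by
  have hg := isGluing_of_mem hs hL hk
  rw [initRun_append hg.sorted, initRun_map_add, length_take,
    min_eq_left (le_peakRun_iff.1 hk).1]
  intro x hx y hy
  have := hg.ltX x hx
  have := hg.leB y hy
  omega

theorem forall_lt_of_mem (hs : s ∈ baseClass m) (hL : L ∈ baseClass j) (hk : k ≤ peakRun s) :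
    ∀ x ∈ s.take k ++ L.map (· + m), x < m + j := by
  have hg := isGluing_of_mem hs hL hk
  intro x hx
  rcases mem_append.1 hx with h | h
  · have := hg.ltX x h; omega
  · exact hg.ltB x h

theorem peakRun_glue (hs : s ∈ baseClass m) (hL : L ∈ baseClass j) (hk : k ≤ peakRun s) :
    peakRun (glue m (m + j) k s L) = k + initRun L := by
  rw [glue, ← append_assoc, peakRun_append_cons (forall_lt_of_mem hs hL hk) (length_glue hs hL hk),
    initRun_take_append hs hL hk]

theorem initRun_glue (hs : s ∈ baseClass m) (hL : L ∈ baseClass j) (hk : k ≤ peakRun s) :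
    initRun (glue m (m + j) k s L) =
      k + initRun L + if initRun L = L.length then 1 else 0 := by
  have hg := isGluing_of_mem hs hL hk
  rw [glue, ← append_assoc, initRun_append_cons (forall_lt_of_mem hs hL hk)
    (fun x hx => (hg.ltR x hx).trans_le hg.le), initRun_take_append hs hL hk]
  simp [min_eq_left (le_peakRun_iff.1 hk).1]

theorem has4132_glue (hs : s ∈ baseClass m) (hL : L ∈ baseClass j) (hk : k ≤ peakRun s) :
    Has4132 (glue m (m + j) k s L) ↔ Has132 (s.drop k) ∨ Has4132 L := by
  rw [glue, (isGluing_of_mem hs hL hk).has4132_iff, has4132_map_add]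

theorem has524361_glue (hs : s ∈ baseClass m) (hL : L ∈ baseClass j) (hk : k ≤ peakRun s) :
    Has524361 (glue m (m + j) k s L) ↔
      Has524361 s ∨ if m = 0 then Has524361 L else Has4132 L := by
  rw [glue, (isGluing_of_mem hs hL hk).has524361_iff, take_append_drop, has524361_map_add,
    has4132_map_add]
  rcases drop_peak hs hk with ⟨h1, h2⟩ | ⟨h1, h2⟩
  · simp [h1, h2]
  · have := ne_nil_of_mem h2
    have := @Has524361.has4132 L
    have : m ≠ 0 := by omega
    simp only [*]
    tauto

/-- An entry of the run of `s` left after the cut, the new maximum `m + j` and the old maximum `m -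
1` form a 132. -/
theorem has132_drop_glue_of_lt (hs : s ∈ baseClass m) (hL : L ∈ baseClass j)
    (hk : k ≤ peakRun s) {q : ℕ} (hq : q < k) : Has132 ((glue m (m + j) k s L).drop q) := by
  have hk' := le_peakRun_iff.1 hk
  have hg := isGluing_of_mem hs hL hk
  have hl : (s.take k).length = k := by simpa using hk'.1
  have hm : m ≠ 0 := by
    rw [← length_of_mem_baseClass hs]
    omega
  have hr := (drop_peak hs hk).resolve_left (by tauto)
  have hx : s[q]'(by omega) ∈ s.take k := by
    rw [mem_take_iff_getElem]
    exact ⟨q, by omega, rfl⟩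
  have hxm := hg.ltX _ hx
  have hxm' : s[q]'(by omega) + 1 ≠ m := by
    have := hk'.2.2 _ hx
    have := length_of_mem_baseClass hs
    omega
  refine ⟨s[q]'(by omega), m + j, m - 1, ?_, by omega, by omega⟩
  rw [glue, drop_append_of_le_length (by omega)]
  have h1 : [s[q]'(by omega)] <+ (s.take k).drop q := by
    rw [singleton_sublist, mem_drop_iff_getElem]
    exact ⟨0, by omega, by simp⟩
  have h2 : [m + j, m - 1] <+ L.map (· + m) ++ (m + j) :: s.drop k := by
    refine Sublist.trans ?_ (sublist_append_right _ _)
    simpa using hr.2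
  exact h1.append h2

theorem drop_glue (hk : k ≤ s.length) {q : ℕ} (hq : q ≤ L.length) (n : ℕ) :
    (glue m n k s L).drop (k + q) = (L.drop q).map (· + m) ++ n :: s.drop k := by
  have hl : (s.take k).length = k := by simpa using hk
  rw [glue, ← drop_drop, drop_left' hl, drop_append_of_le_length (by simpa using hq), map_drop]

theorem has132_drop_glue (hs : s ∈ baseClass m) (hL : L ∈ baseClass j)
    (hk : k ≤ peakRun s) {q : ℕ} (hq : q ≤ L.length) :
    Has132 ((glue m (m + j) k s L).drop (k + q)) ↔ Has132 (L.drop q) ∨ Has132 (s.drop k) := by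
  have hg := isGluing_of_mem hs hL hk
  rw [drop_glue (le_peakRun_iff.1 hk).1 hq, IsGluing.has132_mid_iff (m := m), has132_map_add]
  · intro x hx
    rw [map_drop] at hx
    exact hg.leB x (mem_of_mem_drop hx)
  · intro x hx
    rw [map_drop] at hx
    exact hg.ltB x (mem_of_mem_drop hx)
  · exact hg.ltR
  · exact hg.le

theorem drop_glue_succ (hk : k ≤ s.length) (n : ℕ) :
    (glue m n k s L).drop (k + L.length + 1) = s.drop k := by
  rw [← drop_drop, drop_glue hk le_rfl]
  simp

end glue

end PermPattern

/-! ### Weighted generating functions and their functional equations. -/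

namespace PermPattern

open List PowerSeries

theorem baseClass_zero : baseClass 0 = {[]} := by
  ext l
  rw [Finset.mem_singleton, mem_baseClass]
  constructor
  · rintro ⟨-, h, -⟩
    exact eq_nil_iff_forall_not_mem.2 fun x hx => by simpa using (h x).1 hx
  · rintro rfl
    simp [HasDescentsUp]

theorem mem_baseClass_and_initRun_iff {n : ℕ} {l : List ℕ} :
    l ∈ baseClass n ∧ initRun l = l.length ↔ l = range n := by
  rw [initRun_eq_length_iff]
  constructor
  · rintro ⟨h1, h2⟩
    rw [mem_baseClass] at h1
    exact (perm_range_iff.2 ⟨h1.1, h1.2.1⟩).eq_of_pairwise' h2 pairwise_lt_range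
  · rintro rfl
    refine ⟨mem_baseClass.2 ⟨nodup_range, by simp, ?_⟩, pairwise_lt_range⟩
    rintro ⟨b, a, d, c, hw, h1, -⟩
    have := pairwise_iff_forall_sublist.1 (pairwise_lt_range (n := n))
      ((sublist_append_left [b, a] [d, c]).trans hw)
    omega

variable {R : Type*} [CommRing R]

/-- The generating function of `baseClass` with respect to a weight. -/
noncomputable def weightSeries (w : List ℕ → R) : PowerSeries R :=
  PowerSeries.mk fun n => ∑ l ∈ baseClass n, w l

theorem weightSeries_add (v w : List ℕ → R) :
    weightSeries (fun l => v l + w l) = weightSeries v + weightSeries w := by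
  ext n; simp [weightSeries, Finset.sum_add_distrib]

theorem weightSeries_sub (v w : List ℕ → R) :
    weightSeries (fun l => v l - w l) = weightSeries v - weightSeries w := by
  ext n; simp [weightSeries, Finset.sum_sub_distrib]

theorem weightSeries_const_mul (r : R) (w : List ℕ → R) :
    weightSeries (fun l => r * w l) = PowerSeries.C r * weightSeries w := by
  ext n; simp [weightSeries, Finset.mul_sum]

theorem weightSeries_zero : weightSeries (fun _ => (0 : R)) = 0 := by
  ext n; simp [weightSeries]

/-- The factor `X` accounts for the new maximum. The term `z` is a correction for `m = 0`, where `s`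
is empty and `k = 0` is the only cut. -/
theorem weightSeries_of_glue {w x z : List ℕ → R} {v : List ℕ → ℕ → R}
    (h : ∀ m j k s L, s ∈ baseClass m → L ∈ baseClass j → k ≤ peakRun s →
      w (glue m (m + j) k s L) = v s k * x L + if m = 0 then z L else 0) :
    weightSeries w = PowerSeries.C (w []) + X *
      (weightSeries (fun s => ∑ k ∈ Finset.range (peakRun s + 1), v s k) * weightSeries x +
        weightSeries z) := by
  ext n
  rcases n with _ | n
  · simp [weightSeries, baseClass_zero]
  have h0 : peakRun [] = 0 := rfl
  have hz : ∑ a ∈ Finset.HasAntidiagonal.antidiagonal n, ∑ s ∈ baseClass a.1,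
      ∑ k ∈ Finset.range (peakRun s + 1), ∑ L ∈ baseClass a.2, (if a.1 = 0 then z L else 0) =
      ∑ L ∈ baseClass n, z L := by
    rw [Finset.sum_eq_single (0, n)]
    · simp [baseClass_zero, h0]
    · rintro ⟨m, j⟩ hmj hne
      have : m ≠ 0 := by
        rintro rfl
        simp at hmj
        exact hne (by simp [hmj])
      simp [this]
    · intro hh
      simp at hh
  rw [map_add, coeff_succ_X_mul, map_add, coeff_mul, weightSeries, coeff_mk, sum_baseClass_succ]
  simp only [coeff_C, Nat.succ_ne_zero, if_false, zero_add, weightSeries, coeff_mk]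
  rw [← hz, ← Finset.sum_add_distrib]
  refine Finset.sum_congr rfl ?_
  rintro ⟨m, j⟩ hmj
  obtain rfl : m + j = n := by simpa using hmj
  simp only
  rw [Finset.sum_mul, ← Finset.sum_add_distrib]
  refine Finset.sum_congr rfl fun s hs => ?_
  rw [Finset.sum_mul, ← Finset.sum_add_distrib]
  refine Finset.sum_congr rfl fun k hk => ?_
  rw [Finset.mul_sum, ← Finset.sum_add_distrib]
  refine Finset.sum_congr rfl fun L hL => ?_
  exact h m j k s L hs hL (by simpa [Nat.lt_succ_iff] using hk)

/-- The weight which selects the increasing lists. -/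
def incrWeight (u : R) (l : List ℕ) : R := if initRun l = l.length then u ^ l.length else 0

theorem weightSeries_incrWeight (u : R) :
    weightSeries (incrWeight u) = PowerSeries.mk fun n => u ^ n := by
  ext n
  have h1 := (mem_baseClass_and_initRun_iff (n := n)).2 rfl
  rw [weightSeries, coeff_mk, coeff_mk, Finset.sum_eq_single_of_mem _ h1.1]
  · rw [incrWeight, if_pos h1.2, length_range]
  · intro l hl hne
    rw [incrWeight, if_neg]
    exact fun h => hne (mem_baseClass_and_initRun_iff.1 ⟨hl, h⟩)

theorem mk_pow_mul_one_sub (u : R) :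
    (PowerSeries.mk fun n => u ^ n) * (1 - PowerSeries.C u * X) = 1 := by
  ext n
  rw [mul_sub, mul_one, ← mul_assoc, map_sub]
  rcases n with _ | n
  · simp
  · rw [coeff_succ_mul_X, coeff_mul_C, coeff_mk, coeff_mk, coeff_one, if_neg (by omega)]
    ring

open scoped Classical in
/-- The weight `u ^ r` on permutations avoiding `524361`. -/
noncomputable def weightC (u : R) (r : List ℕ → ℕ) (l : List ℕ) : R :=
  if Has524361 l then 0 else u ^ r l

open scoped Classical in
/-- The weight `u ^ r` on permutations avoiding `4132`. -/
noncomputable def weightD (u : R) (r : List ℕ → ℕ) (l : List ℕ) : R :=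
  if Has4132 l then 0 else u ^ r l

open scoped Classical in
/-- The weight `u ^ k` on the splittings of a permutation avoiding `524361` at position `k`. -/
noncomputable def splitC (u : R) (l : List ℕ) (k : ℕ) : R :=
  if Has524361 l then 0 else u ^ k

open scoped Classical in
/-- The weight `u ^ k` on the splittings at position `k` with second part avoiding `132`. -/
noncomputable def split132 (u : R) (l : List ℕ) (k : ℕ) : R :=
  if Has132 (l.drop k) then 0 else u ^ k

/-- The sum of `v l k` over the initial increasing runs not containing the maximum. -/
noncomputable def sumPeak (v : List ℕ → ℕ → R) (l : List ℕ) : R :=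
  ∑ k ∈ Finset.range (peakRun l + 1), v l k

/-- The sum of `v l k` over the initial increasing runs. -/
noncomputable def sumRun (v : List ℕ → ℕ → R) (l : List ℕ) : R :=
  ∑ k ∈ Finset.range (initRun l + 1), v l k

theorem not_has524361_nil : ¬ Has524361 [] := by simp [Has524361]
theorem not_has4132_nil : ¬ Has4132 [] := by simp [Has4132]
theorem not_has132_nil : ¬ Has132 [] := by simp [Has132]

-- For `m = 0` nothing follows the maximum, so `L` need only avoid 524361 rather than 4132; the last
-- summand makes up the difference.
open scoped Classical in
theorem weightC_glue (u : R) {m j k : ℕ} {s L : List ℕ} {r r' : List ℕ → ℕ}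
    (hs : s ∈ baseClass m) (hL : L ∈ baseClass j) (hk : k ≤ peakRun s)
    (hr : r (glue m (m + j) k s L) = k + r' L) :
    weightC u r (glue m (m + j) k s L) =
      splitC u s k * weightD u r' L + if m = 0 then weightC u r' L - weightD u r' L else 0 := by
  have h := has524361_glue hs hL hk
  simp only [weightC, splitC, weightD, h, hr]
  by_cases hm : m = 0
  · have hs0 : s = [] := by
      rw [← length_eq_zero_iff, length_of_mem_baseClass hs, hm]
    subst hs0
    obtain rfl : k = 0 := by simpa [peakRun, initRun] using hk
    by_cases h1 : Has524361 L <;> by_cases h2 : Has4132 L <;>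
      simp [hm, h1, h2, not_has524361_nil]
  · by_cases h1 : Has524361 s <;> by_cases h2 : Has4132 L <;> simp [hm, h1, h2, pow_add]

open scoped Classical in
theorem weightD_glue (u : R) {m j k : ℕ} {s L : List ℕ} {r r' : List ℕ → ℕ}
    (hs : s ∈ baseClass m) (hL : L ∈ baseClass j) (hk : k ≤ peakRun s)
    (hr : r (glue m (m + j) k s L) = k + r' L) :
    weightD u r (glue m (m + j) k s L) = split132 u s k * weightD u r' L := by
  have h := has4132_glue hs hL hk
  simp only [weightD, split132, h, hr]
  by_cases h1 : Has132 (s.drop k) <;> by_cases h2 : Has4132 L <;> simp [h1, h2, pow_add]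

/-- `initRun`, with one added for increasing lists. -/
def extendedRun (l : List ℕ) : ℕ := initRun l + if initRun l = l.length then 1 else 0

theorem weightD_extendedRun (u : R) (l : List ℕ) :
    weightD u extendedRun l = weightD u initRun l + (u - 1) * incrWeight u l := by
  by_cases h : initRun l = l.length
  · have := not_has4132_of_initRun_eq h
    simp only [weightD, this, extendedRun, incrWeight, h, if_true, if_false]
    ring
  · simp [weightD, extendedRun, incrWeight, h]

/-- The two run statistics differ only on increasing lists, which contain neither pattern, so there
both differences vanish. -/
theorem weightC_sub_weightD_extendedRun (u : R) (l : List ℕ) :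
    weightC u extendedRun l - weightD u extendedRun l =
      weightC u initRun l - weightD u initRun l := by
  by_cases h : initRun l = l.length
  · have h1 := not_has4132_of_initRun_eq h
    have h2 : ¬ Has524361 l := fun hh => h1 hh.has4132
    simp [weightD, weightC, h1, h2]
  · simp [weightD, weightC, extendedRun, h]

theorem weightSeries_weightC_peakRun (u : R) :
    weightSeries (weightC u peakRun) = 1 + X *
      (weightSeries (sumPeak (splitC u)) * weightSeries (weightD u initRun) +
        (weightSeries (weightC u initRun) - weightSeries (weightD u initRun))) := by
  rw [weightSeries_of_glue (w := weightC u peakRun) (v := splitC u) (x := weightD u initRun)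
    (z := fun l => weightC u initRun l - weightD u initRun l), weightSeries_sub]
  · have : weightC u peakRun [] = 1 := by simp [weightC, not_has524361_nil, peakRun, initRun]
    rw [this, map_one]
    rfl
  · intro m j k s L hs hL hk
    exact weightC_glue u hs hL hk (peakRun_glue hs hL hk)

theorem weightSeries_weightC_initRun (u : R) :
    weightSeries (weightC u initRun) = 1 + X *
      (weightSeries (sumPeak (splitC u)) * (weightSeries (weightD u initRun) +
          PowerSeries.C (u - 1) * PowerSeries.mk fun n => u ^ n) +
        (weightSeries (weightC u initRun) - weightSeries (weightD u initRun))) := by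
  conv_lhs => rw [weightSeries_of_glue (w := weightC u initRun) (v := splitC u)
    (x := fun l => weightD u initRun l + (u - 1) * incrWeight u l)
    (z := fun l => weightC u initRun l - weightD u initRun l) (by
      intro m j k s L hs hL hk
      rw [weightC_glue u hs hL hk (r' := extendedRun)
        (by rw [initRun_glue hs hL hk, extendedRun, add_assoc]), weightC_sub_weightD_extendedRun,
        weightD_extendedRun])]
  rw [weightSeries_sub, weightSeries_add, weightSeries_const_mul, weightSeries_incrWeight]
  simp [weightC, not_has524361_nil, initRun]; rfl

theorem weightSeries_weightD_initRun (u : R) :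
    weightSeries (weightD u initRun) = 1 + X *
      (weightSeries (sumPeak (split132 u)) * (weightSeries (weightD u initRun) +
          PowerSeries.C (u - 1) * PowerSeries.mk fun n => u ^ n)) := by
  conv_lhs => rw [weightSeries_of_glue (w := weightD u initRun) (v := split132 u)
    (x := fun l => weightD u initRun l + (u - 1) * incrWeight u l)
    (z := fun _ => 0) (by
      intro m j k s L hs hL hk
      rw [weightD_glue u hs hL hk (r' := extendedRun)
        (by rw [initRun_glue hs hL hk, extendedRun, add_assoc]), weightD_extendedRun]
      simp)]
  rw [weightSeries_zero, weightSeries_add, weightSeries_const_mul, weightSeries_incrWeight]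
  simp [weightD, not_has4132_nil, initRun]; rfl

open scoped Classical in
theorem sum_split132_glue (u : R) {m j k : ℕ} {s L : List ℕ}
    (hs : s ∈ baseClass m) (hL : L ∈ baseClass j) (hk : k ≤ peakRun s) :
    ∑ q ∈ Finset.range (k + initRun L + 1), split132 u (glue m (m + j) k s L) q =
      split132 u s k * sumRun (split132 u) L := by
  rw [add_assoc, Finset.sum_range_add, Finset.sum_eq_zero, zero_add, sumRun, Finset.mul_sum]
  · refine Finset.sum_congr rfl fun q hq => ?_
    have hq' : q ≤ L.length := by
      have := initRun_le_length L
      have := Finset.mem_range.1 hq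
      omega
    have h := has132_drop_glue hs hL hk hq'
    simp only [split132, h]
    by_cases h1 : Has132 (s.drop k) <;> by_cases h2 : Has132 (L.drop q) <;>
      simp [h1, h2, pow_add]
  · intro q hq
    rw [split132, if_pos (has132_drop_glue_of_lt hs hL hk (Finset.mem_range.1 hq))]

theorem weightSeries_sumPeak_split132 (u : R) :
    weightSeries (sumPeak (split132 u)) = 1 + X *
      (weightSeries (sumPeak (split132 u)) * weightSeries (sumRun (split132 u))) := by
  conv_lhs => rw [weightSeries_of_glue (w := sumPeak (split132 u)) (v := split132 u)
    (x := sumRun (split132 u)) (z := fun _ => 0) (by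
      intro m j k s L hs hL hk
      rw [sumPeak, peakRun_glue hs hL hk, sum_split132_glue u hs hL hk]
      simp)]
  rw [weightSeries_zero, add_zero]
  have : sumPeak (split132 u) [] = 1 := by
    simp [sumPeak, peakRun, initRun, split132, not_has132_nil]
  rw [this, map_one]
  rfl

theorem weightSeries_sumRun_split132 (u : R) :
    weightSeries (sumRun (split132 u)) = 1 + X *
      (weightSeries (sumPeak (split132 u)) * (weightSeries (sumRun (split132 u)) +
        PowerSeries.C u * PowerSeries.mk fun n => u ^ n)) := by
  conv_lhs => rw [weightSeries_of_glue (w := sumRun (split132 u)) (v := split132 u)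
    (x := fun l => sumRun (split132 u) l + u * incrWeight u l) (z := fun _ => 0) (by
      intro m j k s L hs hL hk
      rw [sumRun, initRun_glue hs hL hk, mul_add, ← sum_split132_glue u hs hL hk]
      by_cases h : initRun L = L.length
      · have hd := drop_glue_succ (m := m) (L := L) (le_peakRun_iff.1 hk).1 (m + j)
        simp only [h, if_true, incrWeight]
        rw [Finset.sum_range_succ]
        simp only [ite_self, add_zero, add_right_inj]
        rw [split132, hd, split132]
        split_ifs <;> ring
      · simp [h, incrWeight])]
  rw [weightSeries_zero, add_zero, weightSeries_add, weightSeries_const_mul,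
    weightSeries_incrWeight]
  have : sumRun (split132 u) [] = 1 := by
    simp [sumRun, initRun, split132, not_has132_nil]
  rw [this, map_one]
  rfl

/-- Summing the geometric series over the cuts gives the catalytic equation, which involves the
values at 1 and at `u`. -/
theorem one_sub_mul_sumPeak_splitC (u : R) :
    PowerSeries.C (1 - u) * weightSeries (sumPeak (splitC u)) =
      weightSeries (weightC 1 peakRun) - PowerSeries.C u * weightSeries (weightC u peakRun) := by
  rw [← weightSeries_const_mul, ← weightSeries_const_mul, ← weightSeries_sub]
  congr 1
  ext l
  by_cases h : Has524361 l
  · simp [sumPeak, splitC, weightC, h]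
  · simp only [sumPeak, splitC, weightC, h, if_false, one_pow]
    rw [mul_comm, geom_sum_mul_neg, pow_succ']

end PermPattern

/-! ### Identifying the two variables, and the kernel method. -/

namespace PermPattern

open PowerSeries

section diagonal

variable {R : Type*} [CommRing R]

/-- The ring homomorphism `∑ aₙ yⁿ ↦ ∑ aₙ xⁿ` from power series in `y` with coefficients in
`R⟦x⟧` to `R⟦x⟧`. -/
noncomputable def diagonal : PowerSeries (PowerSeries R) →+* PowerSeries R where
  toFun f := PowerSeries.mk fun n =>
    ∑ p ∈ Finset.HasAntidiagonal.antidiagonal n, coeff p.2 (coeff p.1 f)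
  map_zero' := by ext n; simp
  map_add' f g := by ext n; simp [Finset.sum_add_distrib]
  map_one' := by
    ext n
    rw [coeff_mk, Finset.sum_eq_single (0, n)]
    · simp
    · rintro ⟨i, j⟩ h hne
      have : i ≠ 0 := by
        rintro rfl
        simp at h
        exact hne (by simp [h])
      simp [coeff_one, this]
    · simp
  map_mul' f g := by
    ext n
    simp only [coeff_mk, coeff_mul, map_sum, Finset.sum_mul_sum, Finset.sum_sigma']
    -- Both sides sum over four exponents with total `n`; exchanging the two middle ones is an
    -- involution.
    refine Finset.sum_nbij'
      (fun x => ⟨(x.2.1.1 + x.2.2.1, x.2.1.2 + x.2.2.2), (x.2.1.1, x.2.2.1), (x.2.1.2, x.2.2.2)⟩)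
      (fun x => ⟨(x.2.1.1 + x.2.2.1, x.2.1.2 + x.2.2.2), (x.2.1.1, x.2.2.1), (x.2.1.2, x.2.2.2)⟩)
      ?_ ?_ ?_ ?_ fun _ _ => rfl
    all_goals
      rintro ⟨⟨i, j⟩, ⟨p, q⟩, ⟨r, s⟩⟩ h
      simp only [Finset.mem_sigma, Finset.HasAntidiagonal.mem_antidiagonal] at h ⊢
      obtain ⟨rfl, rfl, rfl⟩ := h
    · exact ⟨by omega, trivial, trivial⟩
    · exact ⟨by omega, trivial, trivial⟩
    · rfl
    · rfl

theorem diagonal_C (r : PowerSeries R) : diagonal (PowerSeries.C r) = r := by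
  ext n
  rw [diagonal, RingHom.coe_mk, MonoidHom.coe_mk, OneHom.coe_mk, coeff_mk, Finset.sum_eq_single (0, n)]
  · simp
  · rintro ⟨i, j⟩ h hne
    have : i ≠ 0 := by
      rintro rfl
      simp at h
      exact hne (by simp [h])
    simp [coeff_C, this]
  · simp

theorem diagonal_X : diagonal (X : PowerSeries (PowerSeries R)) = X := by
  ext n
  rw [diagonal, RingHom.coe_mk, MonoidHom.coe_mk, OneHom.coe_mk, coeff_mk]
  rcases n with _ | n
  · simp
  rw [Finset.sum_eq_single (1, n)]
  · simp [coeff_one, coeff_X]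
  · rintro ⟨i, j⟩ h hne
    have : i ≠ 1 := by
      rintro rfl
      simp at h
      exact hne (by simp; omega)
    simp [coeff_X, this]
  · intro h
    simp at h
    omega

theorem diagonal_map_C (f : PowerSeries R) :
    diagonal (PowerSeries.map (PowerSeries.C : R →+* PowerSeries R) f) = f := by
  ext n
  rw [diagonal, RingHom.coe_mk, MonoidHom.coe_mk, OneHom.coe_mk, coeff_mk, Finset.sum_eq_single (n, 0)]
  · simp
  · rintro ⟨i, j⟩ h hne
    have : j ≠ 0 := by
      rintro rfl
      simp at h
      exact hne (by simp [h])
    simp [coeff_C, this]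
  · simp

end diagonal

/-- The difference factors as `(c - u) * (1 - X * (g * (c + u)))`, whose second factor has constant
term 1. -/
theorem eq_of_quadratic {g c u : PowerSeries ℚ} (hc : c = 1 + X * g * c ^ 2)
    (hu : u = 1 + X * g * u ^ 2) : c = u := by
  have h : (c - u) * (1 - X * (g * (c + u))) = 0 := by linear_combination hc - hu
  rcases mul_eq_zero.1 h with h | h
  · exact sub_eq_zero.1 h
  · have := congrArg constantCoeff h
    simp at this

/-- Solution of the system of functional equations at the root of its kernel. -/
theorem solve_kernel {u g c A GD GC F H Cc : PowerSeries ℚ} (hu0 : constantCoeff u = 1)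
    (hu : X * u * (2 * u - 1) = u - 1)
    (hg : g * (1 - u * X) = 1)
    (hc : c = 1 + X * (c * A))
    (hA : A = 1 + X * (c * (A + u * g)))
    (hGD : GD = 1 + X * (c * (GD + (u - 1) * g)))
    (hF : F = 1 + X * (H * GD + (GC - GD)))
    (hGC : GC = 1 + X * (H * (GD + (u - 1) * g) + (GC - GD)))
    (hH : (1 - u) * H = Cc - u * F) :
    Cc = 1 + X * (2 * u - 1) := by
  have hgu : g * u = 2 * u - 1 := by linear_combination (2 * u - 1) * hg + g * hu
  have hAc : A = c * g := by linear_combination hA - hc - c * hg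
  -- At the kernel root the series of 132-avoiding splittings equals `u` itself, since both solve
  -- the same quadratic equation.
  have hcu : c = u := by
    refine eq_of_quadratic (g := g) ?_ ?_
    · rw [hAc] at hc; linear_combination hc
    · linear_combination -hu - X * u * hgu
  subst hcu
  obtain ⟨v, hv⟩ : ∃ v, c * v = 1 := ⟨c⁻¹, PowerSeries.mul_inv_cancel _ (by simp [hu0])⟩
  have hgv : g = 2 - v := by linear_combination v * hgu + (2 - g) * hv
  subst hgv
  have hX : X * (2 - v) = v - v ^ 2 := by
    linear_combination v ^ 2 * hu + (X * (v - 2 * (c * v + 1)) + v) * hv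
  have hGD' : GD = (2 - v) * (c + v - 1) := by
    linear_combination (2 - v) * hGD - GD * hg +
      (2 - v) * ((c - 1) * c * hX + ((c - 1) * (1 - v) - 1) * hv)
  have hXGD : X * GD = (v - v ^ 2) * (c + v - 1) := by
    linear_combination X * hGD' + (c + v - 1) * hX
  have hGF : GC = F + X * H * (c - 1) * (2 - v) := by linear_combination hGC - hF
  have hF' : (1 - X) * F = 1 + X * H * GD + X ^ 2 * H * (c - 1) * (2 - v) - X * GD := by
    linear_combination hF + X * hGF
  -- This is the kernel: the coefficient of `H` once `F` is eliminated between `hF'` and `hH`.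
  have hK : (1 - X) * (1 - c) + c * X * GD + c * X ^ 2 * (c - 1) * (2 - v) = 0 := by
    linear_combination c * hXGD + (c * X * (c - 1) + (c - 1)) * hX +
      ((1 - v) * ((c + v - 1) + X * (c - 1)) - v) * hv
  have hL : c * (1 - X * GD) = (1 - X) * (2 - v) := by
    linear_combination -c * hXGD + hX + (1 - (1 - v) * (c + v - 1)) * hv
  have h1 : (1 - X) * Cc = (1 - X) * (2 - v) := by
    linear_combination -(1 - X) * hH + c * hF' + H * hK + hL
  have h2 : (1 - X : PowerSeries ℚ) ≠ 0 := by
    intro h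
    have := congrArg constantCoeff h
    simp at this
  rw [mul_left_cancel₀ h2 h1]
  linear_combination (-v) * hu + (X * (2 * c - 1) - 1) * hv

end PermPattern

/-! ### Permutations and their one-line notations. -/

namespace PermPattern

open List

/-- The one-line notation of a permutation. -/
def oneLine {n : ℕ} (π : Equiv.Perm (Fin n)) : List ℕ := ofFn fun i => (π i : ℕ)

theorem contains_iff {n k : ℕ} (π : Equiv.Perm (Fin n)) (τ : Equiv.Perm (Fin k)) :
    Contains π τ ↔
      ∃ w : Fin k → ℕ, ofFn w <+ oneLine π ∧ ∀ i j, w i < w j ↔ τ i < τ j := by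
  constructor
  · rintro ⟨f, hf⟩
    refine ⟨fun i => π (f i), ?_, fun i j => by simpa using hf i j⟩
    rw [sublist_iff_exists_fin_orderEmbedding_get_eq]
    refine ⟨(Fin.castOrderIso (by simp)).toOrderEmbedding.trans
      (f.trans (Fin.castOrderIso (by simp [oneLine])).toOrderEmbedding), fun i => ?_⟩
    simp [oneLine]
    rfl
  · rintro ⟨w, hw, h⟩
    obtain ⟨f, hf⟩ := sublist_iff_exists_fin_orderEmbedding_get_eq.1 hw
    let f' : Fin k ↪o Fin n := (Fin.castOrderIso (by simp)).toOrderEmbedding.trans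
      (f.trans (Fin.castOrderIso (by simp [oneLine])).toOrderEmbedding)
    have hf' : ∀ i, w i = π (f' i) := by
      intro i
      have := hf (Fin.cast (by simp) i)
      simp only [oneLine, get_ofFn] at this
      exact this
    refine ⟨f', fun i j => ?_⟩
    rw [← h, hf', hf']
    simp

theorem oneLine_nodup {n : ℕ} (π : Equiv.Perm (Fin n)) : (oneLine π).Nodup :=
  nodup_ofFn.2 (Fin.val_injective.comp π.injective)

theorem mem_oneLine {n : ℕ} (π : Equiv.Perm (Fin n)) (x : ℕ) : x ∈ oneLine π ↔ x < n := by
  rw [oneLine, mem_ofFn]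
  constructor
  · rintro ⟨i, rfl⟩
    exact (π i).2
  · intro h
    exact ⟨π.symm ⟨x, h⟩, by simp⟩

theorem oneLine_injective (n : ℕ) : Function.Injective (oneLine (n := n)) := by
  intro π π' h
  ext i
  exact congrFun (ofFn_injective h) i

theorem exists_oneLine_eq {n : ℕ} {l : List ℕ} (h1 : l.Nodup) (h2 : ∀ x, x ∈ l ↔ x < n) :
    ∃ π : Equiv.Perm (Fin n), oneLine π = l := by
  have hl : l.length = n := by simpa using (perm_range_iff.2 ⟨h1, h2⟩).length_eq
  subst hl
  let f : Fin l.length → Fin l.length := fun i => ⟨l.get i, (h2 _).1 (get_mem l i)⟩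
  have hf : Function.Injective f := by
    intro i j hij
    exact nodup_iff_injective_get.1 h1 (congrArg Fin.val hij)
  refine ⟨Equiv.ofBijective f (Finite.injective_iff_bijective.1 hf), ?_⟩
  simp [oneLine, f]

/-- The inequalities leave only the order of `b` and `c` open: `b < c` gives 2143 and `c < b` gives
3142. -/
theorem hasDescentsUp_oneLine {n : ℕ} (π : Equiv.Perm (Fin n)) :
    HasDescentsUp (oneLine π) ↔ Contains π p2143 ∨ Contains π p3142 := by
  rw [contains_iff, contains_iff]
  constructor
  · rintro ⟨b, a, d, c, hw, h1, h2, h3, h4⟩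
    have hbc : b ≠ c := by
      have := (oneLine_nodup π).sublist hw
      simp at this
      tauto
    have hw' : ofFn ![b, a, d, c] <+ oneLine π := by simpa using hw
    rcases lt_or_gt_of_ne hbc with h | h
    · refine .inl ⟨_, hw', fun i j => ?_⟩
      fin_cases i <;> fin_cases j <;> simp [p2143] <;> omega
    · refine .inr ⟨_, hw', fun i j => ?_⟩
      fin_cases i <;> fin_cases j <;> simp [p3142] <;> omega
  · rintro (⟨w, hw, h⟩ | ⟨w, hw, h⟩)
    all_goals
      refine ⟨w 0, w 1, w 2, w 3, by simpa [ofFn_succ] using hw, ?_, ?_, ?_, ?_⟩ <;>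
        rw [h] <;> decide

theorem has524361_oneLine {n : ℕ} (π : Equiv.Perm (Fin n)) :
    Has524361 (oneLine π) ↔ Contains π p524361 := by
  rw [contains_iff]
  constructor
  · rintro ⟨e, b, d, c, f, a, hw, h1, h2, h3, h4, h5⟩
    refine ⟨![e, b, d, c, f, a], by simpa using hw, fun i j => ?_⟩
    fin_cases i <;> fin_cases j <;> simp [p524361] <;> omega
  · rintro ⟨w, hw, h⟩
    refine ⟨w 0, w 1, w 2, w 3, w 4, w 5, by simpa [ofFn_succ] using hw, ?_, ?_, ?_, ?_, ?_⟩ <;>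
      rw [h] <;> decide

open scoped Classical in
theorem ncard_classC (n : ℕ) :
    (classC p524361 n).ncard = ((baseClass n).filter fun l => ¬ Has524361 l).card := by
  rw [← Set.ncard_image_of_injective _ (oneLine_injective n), ← Set.ncard_coe_finset]
  congr 1
  ext l
  have key : ∀ π : Equiv.Perm (Fin n), π ∈ classC p524361 n ↔
      ¬ HasDescentsUp (oneLine π) ∧ ¬ Has524361 (oneLine π) := by
    intro π
    rw [hasDescentsUp_oneLine, has524361_oneLine]
    simp [classC, Av, Avoids, and_assoc]
  simp only [Set.mem_image, Finset.coe_filter, Set.mem_ofPred_eq, mem_baseClass]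
  constructor
  · rintro ⟨π, hπ, rfl⟩
    rw [key] at hπ
    exact ⟨⟨oneLine_nodup π, mem_oneLine π, hπ.1⟩, hπ.2⟩
  · rintro ⟨⟨h1, h2, h3⟩, h4⟩
    obtain ⟨π, rfl⟩ := exists_oneLine_eq h1 h2
    exact ⟨π, (key π).2 ⟨h3, h4⟩, rfl⟩

end PermPattern

/-! ### Evaluation by the large Schröder series. -/

namespace PermPattern

open PowerSeries

/-- The generating function of the large Schröder numbers with rational coefficients. -/
noncomputable def schroderSeries : PowerSeries ℚ :=
  PowerSeries.map (Nat.castRingHom ℚ) largeSchroderSeries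

theorem schroderSeries_eq :
    schroderSeries = 1 + X * schroderSeries + X * schroderSeries ^ 2 := by
  have := congrArg (PowerSeries.map (Nat.castRingHom ℚ))
    largeSchroderSeries_eq_one_add_X_mul_largeSchroderSeries_add_X_mul_largeSchroderSeries_sq
  simpa [schroderSeries] using this

theorem weightSeries_weightC_one :
    weightSeries (weightC (1 : PowerSeries ℚ) peakRun) =
      PowerSeries.map (PowerSeries.C : ℚ →+* PowerSeries ℚ) (genFun p524361) := by
  classical
  ext1 n
  rw [coeff_map, genFun, coeff_mk, ncard_classC, weightSeries, coeff_mk, Finset.card_filter]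
  simp [weightC]

theorem genFun_eq : genFun p524361 = 1 + X * schroderSeries := by
  have hs := schroderSeries_eq
  have h2 : PowerSeries.C (1 / 2 : ℚ) * 2 = 1 := by
    rw [← map_ofNat (PowerSeries.C : ℚ →+* PowerSeries ℚ) 2, ← map_mul]
    norm_num
  -- The kernel root: the Schröder equation becomes `X * u * (2 * u - 1) = u - 1`.
  obtain ⟨u, hu⟩ : ∃ u, u = PowerSeries.C (1 / 2 : ℚ) * (1 + schroderSeries) := ⟨_, rfl⟩
  have hsu : schroderSeries = 2 * u - 1 := by
    linear_combination -2 * hu - (1 + schroderSeries) * h2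
  have hu0 : constantCoeff u = 1 := by
    have h0 := congrArg constantCoeff hs
    simp at h0
    rw [hu, map_mul, map_add, h0]
    norm_num
  rw [hsu] at hs ⊢
  have hg := congrArg diagonal (mk_pow_mul_one_sub u)
  have hc := congrArg diagonal (weightSeries_sumPeak_split132 u)
  have hA := congrArg diagonal (weightSeries_sumRun_split132 u)
  have hGD := congrArg diagonal (weightSeries_weightD_initRun u)
  have hF := congrArg diagonal (weightSeries_weightC_peakRun u)
  have hGC := congrArg diagonal (weightSeries_weightC_initRun u)
  have hH := congrArg diagonal (one_sub_mul_sumPeak_splitC u)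
  rw [weightSeries_weightC_one] at hH
  simp only [map_mul, map_add, map_sub, map_one, diagonal_C, diagonal_X, diagonal_map_C]
    at hg hc hA hGD hF hGC hH
  refine solve_kernel hu0 ?_ hg hc hA hGD hF hGC hH
  linear_combination (-u * X * (2 * u - 1) - 1 + u) * h2 - PowerSeries.C (1 / 2 : ℚ) * hs

theorem ncard_classC_succ (n : ℕ) : (classC p524361 (n + 1)).ncard = Nat.largeSchroder n := by
  have h := congrArg (coeff (n + 1)) genFun_eq
  rw [genFun, coeff_mk, map_add, coeff_succ_X_mul, coeff_one, if_neg (by omega), zero_add,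
    schroderSeries, coeff_map, coeff_largeSchroderSeries, eq_natCast] at h
  exact_mod_cast h

theorem ncard_classC_zero : (classC p524361 0).ncard = 1 := by
  have h := congrArg (coeff 0) genFun_eq
  rw [genFun, coeff_mk, map_add, coeff_zero_X_mul, coeff_one, if_pos rfl, add_zero] at h
  exact_mod_cast h

end PermPattern

theorem mainTheorem2 :
    (PermPattern.classC PermPattern.p524361 0).ncard = 1 ∧
    (∀ n : ℕ, (PermPattern.classC PermPattern.p524361 (n + 1)).ncard = Nat.largeSchroder n) ∧
    ∃ S : PowerSeries ℚ,
      PermPattern.IsPrincipalSqrt S (1 - 6 * PowerSeries.X + PowerSeries.X ^ 2) ∧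
      PermPattern.genFun PermPattern.p524361 =
        PowerSeries.C (1 / 2 : ℚ) * (3 - PowerSeries.X - S) := by
  refine ⟨PermPattern.ncard_classC_zero, PermPattern.ncard_classC_succ,
    1 - PowerSeries.X - 2 * PowerSeries.X * PermPattern.schroderSeries, ⟨?_, ?_⟩, ?_⟩
  · linear_combination (-4 * PowerSeries.X) * PermPattern.schroderSeries_eq
  · simp
  · have h2 : PowerSeries.C (1 / 2 : ℚ) * 2 = 1 := by
      rw [← map_ofNat (PowerSeries.C : ℚ →+* PowerSeries ℚ) 2, ← map_mul]
      norm_num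
    rw [PermPattern.genFun_eq]
    linear_combination (-1 - PowerSeries.X * PermPattern.schroderSeries) * h2
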